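/- There is a universal constant $c>0$ such that the following holds. Let $d\ge 2$ be an integer and let $L,B,\epsilon>0$. Then there is $N=N(d,L,B,\epsilon)$ such that for every $n\ge N$, every feature map $\phi:\mathcal S\times\mathcal A\to\mathbb R^d$ with $\|\phi(s,a)\|\le L$ for all $(s,a)$, and every fixed design $(s_i,a_i^0,a_i^1)_{i=1}^n$ in $\mathcal S\times\mathcal A\times\mathcal A$, the following is true. For $\theta\in\mathbb R^d$ let the labels $y_1,\dots,y_n\in\{0,1\}$ be independent and follow the Bradley–Terry–Luce model with linear reward, $$\mathbb P_\theta[y_i=l]=\frac{\exp(\phi(s_i,a_i^l)^\top\theta)}{\exp(\phi(s_i,a_i^0)^\top\theta)+\exp(\phi(s_i,a_i^1)^\top\theta)},\qquad l\in\{0,1\}.$$ Each label is privatized independently by an $\epsilon$-label-DP local randomizer $\mathcal R_i$ (with values in an arbitrary measurable space), i.e. $\mathbb P[\mathcal R_i(y)\in E]\le e^{\epsilon}\,\mathbb P[\mathcal R_i(y')\in E]$ for all $y,y'\in\{0,1\}$ and all measurable $E$. Let $\hat\theta$ be any (possibly randomized) estimator with values in $\mathbb R^d$ that is computed from the privatized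 labels $\mathcal R_1(y_1),\dots,\mathcal R_n(y_n)$ (the design, $\phi$ and the randomizers being known). Then there is a parameter $\theta^*\in\Theta_B=\{\theta\in\mathbb R^d:\langle\mathbf 1,\theta\rangle=0,\ \|\theta\|\le B\}$ such that, when the labels are generated with $\theta=\theta^*$, $$\mathbb E\,\|\hat\theta-\theta^*\|^2\;\ge\; c\,\frac{d}{L^2}\left(\frac dn+\frac{d}{(e^{\epsilon}-1)^2\,n}\right),$$ where $\|\cdot\|$ is the Euclidean norm and the expectation is over the labels, the randomizers and the estimator. In particular, the worst-case risk over $\Theta_B$ of every locally $\epsilon$-label-DP estimator is $\Omega\!\left(\frac{d}{L^2}\left(\frac dn+\frac{d}{(e^\epsilon-1)^2n}\right)\right)$. -/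

import Mathlib

/-!
Assouad's method on a cube with vertices `θ = ∑ j, ± δ • u j`, where `u` is an orthonormal basis of
the hyperplane `⟨𝟏, θ⟩ = 0`. Write `x i` for the feature difference of query `i`, so that label `i`
equals `1` with probability `sigmoid ⟨x i, θ⟩`.

* Privacy makes the densities of the two output laws of a randomizer, taken with respect to the sum
  of these laws, differ by at most `τ = (exp ε - 1) / (exp ε + 1)`. Hence the squared Hellinger
  distance between the laws of a privatized label at two label probabilities `p` and `q`, both in
  `[1/4, 3/4]`, is at most `(p - q) ^ 2 * τ ^ 2`.
* Flipping coordinate `j` moves the probability of label `i` by at most `δ * |⟨x i, u j⟩| / 2`, and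
  Bessel's inequality bounds `∑ j, ⟨x i, u j⟩ ^ 2` by `‖x i‖ ^ 2 ≤ 4 * L ^ 2`, whatever the
  dimension. Squared Hellinger distance is subadditive over products, so the distances along the
  `d - 1` edges at a vertex sum to at most `n * δ ^ 2 * L ^ 2 * τ ^ 2`.
* With `δ ^ 2 = (d - 1) / (4 * n * L ^ 2 * τ ^ 2)` this is `(d - 1) / 4`, so a constant fraction of
  the coordinates cannot be estimated to accuracy `δ`, and some vertex has risk at least
  `δ ^ 2 * (d - 1) / 3`. The rate follows from `1 / τ ^ 2 ≥ 1 + 1 / (exp ε - 1) ^ 2`; for large `n`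
  the cube lies in the ball of radius `B` and all label probabilities lie in `[1/4, 3/4]`.
-/

open MeasureTheory ProbabilityTheory
open scoped ENNReal

namespace LabelDP

/-- The parameter set `Θ_B = {θ ∈ ℝᵈ : ⟨𝟏, θ⟩ = 0, ‖θ‖₂ ≤ B}`. -/
def paramSet (d : ℕ) (B : ℝ) : Set (EuclideanSpace ℝ (Fin d)) :=
  {θ | ∑ j, θ j = 0 ∧ ‖θ‖ ≤ B}

/-- The linear reward `r_θ(s, a) = φ(s, a)ᵀ θ`. -/
noncomputable def reward {S A : Type*} {d : ℕ} (φ : S → A → EuclideanSpace ℝ (Fin d))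
    (θ : EuclideanSpace ℝ (Fin d)) (s : S) (a : A) : ℝ :=
  inner ℝ (φ s a) θ

/-- The Bradley-Terry-Luce probability that the label is `l ∈ {0, 1}`, at the state `s` and for
the pair of actions `(a 0, a 1)`. -/
noncomputable def btlProb {S A : Type*} {d : ℕ} (φ : S → A → EuclideanSpace ℝ (Fin d))
    (θ : EuclideanSpace ℝ (Fin d)) (s : S) (a : Fin 2 → A) (l : Fin 2) : ℝ :=
  Real.exp (reward φ θ s (a l)) /
    (Real.exp (reward φ θ s (a 0)) + Real.exp (reward φ θ s (a 1)))

/-- The Bradley-Terry-Luce law of a label, as a measure on `{0, 1}`. -/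
noncomputable def labelLaw {S A : Type*} {d : ℕ} (φ : S → A → EuclideanSpace ℝ (Fin d))
    (θ : EuclideanSpace ℝ (Fin d)) (s : S) (a : Fin 2 → A) : Measure (Fin 2) :=
  ∑ l, ENNReal.ofReal (btlProb φ θ s a l) • Measure.dirac l

/-- The label law is a probability measure. -/
instance isProbabilityMeasure_labelLaw {S A : Type*} {d : ℕ}
    (φ : S → A → EuclideanSpace ℝ (Fin d)) (θ : EuclideanSpace ℝ (Fin d)) (s : S)
    (a : Fin 2 → A) : IsProbabilityMeasure (labelLaw φ θ s a) := by
  constructor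
  have h0 : 0 ≤ btlProb φ θ s a 0 := by unfold btlProb; positivity
  have h1 : 0 ≤ btlProb φ θ s a 1 := by unfold btlProb; positivity
  have hs : btlProb φ θ s a 0 + btlProb φ θ s a 1 = 1 := by
    unfold btlProb
    rw [← add_div]
    exact div_self (by positivity)
  simp only [labelLaw, Fin.sum_univ_two, Measure.coe_add, Measure.coe_smul, Pi.add_apply,
    Pi.smul_apply, measure_univ, smul_eq_mul, mul_one]
  rw [← ENNReal.ofReal_add h0 h1, hs, ENNReal.ofReal_one]

/-- The randomizer `R`, a Markov kernel from labels to an output space `Z`, is an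
`(ε, δ)`-label differentially private local randomizer. -/
def IsLabelDPRandomizer {Z : Type*} [MeasurableSpace Z] (ε δ : ℝ) (R : Kernel (Fin 2) Z) : Prop :=
  ∀ (y y' : Fin 2) (E : Set Z), MeasurableSet E →
    R y E ≤ ENNReal.ofReal (Real.exp ε) * R y' E + ENNReal.ofReal δ

/-- The joint law of the privatized labels `(R₁(y₁), …, Rₙ(yₙ))`, where the labels `yᵢ` are
independent and follow the Bradley-Terry-Luce model with parameter `θ` at the queries
`(sᵢ, aᵢ⁰, aᵢ¹)`, and each labeler applies her own randomizer `Rᵢ` independently. -/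
noncomputable def privateLaw {S A : Type*} {d n : ℕ} (φ : S → A → EuclideanSpace ℝ (Fin d))
    (θ : EuclideanSpace ℝ (Fin d)) (s : Fin n → S) (a : Fin n → Fin 2 → A)
    {Z : Fin n → Type*} [∀ i, MeasurableSpace (Z i)] (R : ∀ i, Kernel (Fin 2) (Z i)) :
    Measure (∀ i, Z i) :=
  Measure.pi fun i => (labelLaw φ θ (s i) (a i)).bind (R i)

/-- The expected squared `ℓ₂` error `𝔼 ‖θ̂ - θ‖²`, in `[0, ∞]`, of the (possibly randomized)
estimator `est`, which maps the privatized labels to a random element of `ℝᵈ`. -/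
noncomputable def l2Risk {S A : Type*} {d n : ℕ} (φ : S → A → EuclideanSpace ℝ (Fin d))
    (θ : EuclideanSpace ℝ (Fin d)) (s : Fin n → S) (a : Fin n → Fin 2 → A)
    {Z : Fin n → Type*} [∀ i, MeasurableSpace (Z i)] (R : ∀ i, Kernel (Fin 2) (Z i))
    (est : Kernel (∀ i, Z i) (EuclideanSpace ℝ (Fin d))) : ℝ≥0∞ :=
  ∫⁻ z, ∫⁻ t, ‖t - θ‖ₑ ^ 2 ∂(est z) ∂(privateLaw φ θ s a R)

end LabelDP

namespace LabelDP

/-- `f` is a nonnegative measurable version of the density of `P` with respect to `ν`. It is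
real-valued so that products, square roots and differences of densities are taken in `ℝ`. -/
structure IsDensity {Z : Type*} [MeasurableSpace Z] (P ν : Measure Z) (f : Z → ℝ) : Prop where
  measurable : Measurable f
  nonneg : ∀ z, 0 ≤ f z
  withDensity_eq : ν.withDensity (fun z => ENNReal.ofReal (f z)) = P

namespace IsDensity

variable {Z : Type*} [MeasurableSpace Z] {P Q ν : Measure Z} {f g : Z → ℝ}

theorem lintegral_eq (hf : IsDensity P ν f) :
    ∫⁻ z, ENNReal.ofReal (f z) ∂ν = P Set.univ := by
  rw [← setLIntegral_univ, ← withDensity_apply _ MeasurableSet.univ, hf.withDensity_eq]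

theorem lintegral_mul (hf : IsDensity P ν f) {ℓ : Z → ℝ≥0∞} (hℓ : Measurable ℓ) :
    ∫⁻ z, ℓ z ∂P = ∫⁻ z, ENNReal.ofReal (f z) * ℓ z ∂ν := by
  rw [← hf.withDensity_eq,
    lintegral_withDensity_eq_lintegral_mul _ hf.measurable.ennreal_ofReal hℓ]
  rfl

theorem integrable [IsFiniteMeasure P] (hf : IsDensity P ν f) : Integrable f ν := by
  refine ⟨hf.measurable.aestronglyMeasurable, ?_⟩
  rw [hasFiniteIntegral_iff_ofReal (ae_of_all _ hf.nonneg), hf.lintegral_eq]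
  exact measure_lt_top P _

theorem integral_eq_one [IsProbabilityMeasure P] (hf : IsDensity P ν f) : ∫ z, f z ∂ν = 1 := by
  rw [integral_eq_lintegral_of_nonneg_ae (ae_of_all _ hf.nonneg)
    hf.measurable.aestronglyMeasurable, hf.lintegral_eq, measure_univ, ENNReal.toReal_one]

theorem restrict (hf : IsDensity P ν f) {s : Set Z} (hs : MeasurableSet s) :
    IsDensity (P.restrict s) (ν.restrict s) f where
  measurable := hf.measurable
  nonneg := hf.nonneg
  withDensity_eq := by rw [← restrict_withDensity hs, hf.withDensity_eq]

theorem convexComb (hf : IsDensity P ν f) (hg : IsDensity Q ν g) {q : ℝ} (hq : q ∈ Set.Icc 0 1) :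
    IsDensity (ENNReal.ofReal (1 - q) • P + ENNReal.ofReal q • Q) ν
      (fun z => (1 - q) * f z + q * g z) where
  measurable := (hf.measurable.const_mul _).add (hg.measurable.const_mul _)
  nonneg z := add_nonneg (mul_nonneg (sub_nonneg.2 hq.2) (hf.nonneg z))
    (mul_nonneg hq.1 (hg.nonneg z))
  withDensity_eq := by
    rw [← hf.withDensity_eq, ← hg.withDensity_eq,
      ← withDensity_smul _ hf.measurable.ennreal_ofReal,
      ← withDensity_smul _ hg.measurable.ennreal_ofReal,
      ← withDensity_add_left (hf.measurable.ennreal_ofReal.const_smul _)]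
    congr 1 with z
    have hq' : 0 ≤ 1 - q := sub_nonneg.2 hq.2
    simp only [Pi.add_apply, Pi.smul_apply, smul_eq_mul]
    rw [ENNReal.ofReal_add (mul_nonneg hq' (hf.nonneg z)) (mul_nonneg hq.1 (hg.nonneg z)),
      ENNReal.ofReal_mul hq', ENNReal.ofReal_mul hq.1]

section Pi

variable {ι : Type*} [Fintype ι] {Z : ι → Type*} [∀ i, MeasurableSpace (Z i)]
  {P ν : ∀ i, Measure (Z i)} [∀ i, IsFiniteMeasure (P i)] [∀ i, SigmaFinite (ν i)]
  {f : ∀ i, Z i → ℝ}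

theorem lintegral_pi (hf : ∀ i, IsDensity (P i) (ν i) (f i)) :
    ∫⁻ z, ENNReal.ofReal (∏ i, f i (z i)) ∂Measure.pi ν = ∏ i, P i Set.univ := by
  rw [← ofReal_integral_eq_lintegral_ofReal
      (Integrable.fintype_prod_dep fun i => (hf i).integrable)
      (ae_of_all _ fun z => Finset.prod_nonneg fun i _ => (hf i).nonneg _),
    integral_fintype_prod_eq_prod,
    ENNReal.ofReal_prod_of_nonneg fun i _ => integral_nonneg (hf i).nonneg]
  refine Finset.prod_congr rfl fun i _ => ?_
  rw [ofReal_integral_eq_lintegral_ofReal (hf i).integrable (ae_of_all _ (hf i).nonneg),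
    (hf i).lintegral_eq]

protected theorem pi (hf : ∀ i, IsDensity (P i) (ν i) (f i)) :
    IsDensity (Measure.pi P) (Measure.pi ν) (fun z => ∏ i, f i (z i)) where
  measurable := Finset.measurable_fun_prod _ fun i _ =>
    (hf i).measurable.comp (measurable_pi_apply i)
  nonneg z := Finset.prod_nonneg fun i _ => (hf i).nonneg _
  withDensity_eq := by
    refine (Measure.pi_eq fun s hs => ?_).symm
    rw [withDensity_apply _ (MeasurableSet.univ_pi hs), Measure.restrict_pi_pi,
      lintegral_pi fun i => (hf i).restrict (hs i)]
    simp only [Measure.restrict_apply_univ]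

end Pi

end IsDensity

/-- The squared Hellinger distance `1 - ∫ √(f g) = ½ ∫ (√f - √g) ^ 2` of two probability densities
`f` and `g` with respect to `ν`. -/
noncomputable def sqHellinger {Z : Type*} [MeasurableSpace Z] (ν : Measure Z) (f g : Z → ℝ) : ℝ :=
  1 - ∫ z, √(f z * g z) ∂ν

theorem sqrt_mul_le_half_add {a b : ℝ} (ha : 0 ≤ a) (hb : 0 ≤ b) : √(a * b) ≤ (a + b) / 2 := by
  rw [Real.sqrt_le_left (by positivity)]
  nlinarith [sq_nonneg (a - b)]

theorem sqrt_mul_le_min_add_max {a b : ℝ} (ha : 0 ≤ a) (hb : 0 ≤ b) :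
    √(a * b) ≤ min a b + max a b / 4 := by
  have : 0 ≤ min a b := le_min ha hb
  have : 0 ≤ max a b := ha.trans (le_max_left a b)
  rw [← min_mul_max a b, Real.sqrt_le_left (by positivity)]
  nlinarith [sq_nonneg (min a b - max a b / 4)]

theorem half_add_sub_le_sqrt_mul {m a b : ℝ} (hm : 0 < m) (ha : m ≤ a) (hb : m ≤ b) :
    (a + b) / 2 - (a - b) ^ 2 / (8 * m) ≤ √(a * b) := by
  have ha0 : 0 ≤ a := hm.le.trans ha
  have hb0 : 0 ≤ b := hm.le.trans hb
  have hsum : 4 * m ≤ (√a + √b) ^ 2 := by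
    have := Real.sqrt_le_sqrt ha
    have := Real.sqrt_le_sqrt hb
    have := Real.sqrt_nonneg m
    nlinarith [Real.sq_sqrt hm.le]
  have hdiff : (a - b) ^ 2 = (√a - √b) ^ 2 * (√a + √b) ^ 2 := by
    rw [← mul_pow, mul_comm, ← sq_sub_sq, Real.sq_sqrt ha0, Real.sq_sqrt hb0]
  have hsq : (√a - √b) ^ 2 / 2 ≤ (a - b) ^ 2 / (8 * m) := by
    rw [hdiff, div_le_div_iff₀ two_pos (by positivity)]
    nlinarith [mul_le_mul_of_nonneg_left hsum (sq_nonneg (√a - √b))]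
  rw [Real.sqrt_mul ha0]
  nlinarith [Real.sq_sqrt ha0, Real.sq_sqrt hb0]

theorem IsDensity.integrable_sqrt_mul {Z : Type*} [MeasurableSpace Z] {P Q ν : Measure Z}
    [IsFiniteMeasure P] [IsFiniteMeasure Q] {f g : Z → ℝ} (hf : IsDensity P ν f)
    (hg : IsDensity Q ν g) :
    Integrable (fun z => √(f z * g z)) ν := by
  refine ((hf.integrable.add hg.integrable).div_const 2).mono'
    (hf.measurable.mul hg.measurable).sqrt.aestronglyMeasurable (ae_of_all _ fun z => ?_)
  rw [Real.norm_of_nonneg (Real.sqrt_nonneg _)]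
  exact sqrt_mul_le_half_add (hf.nonneg z) (hg.nonneg z)

section Hellinger

variable {Z : Type*} [MeasurableSpace Z] {P Q ν : Measure Z} [IsProbabilityMeasure P]
  [IsProbabilityMeasure Q] {f g : Z → ℝ}

theorem IsDensity.integral_half_add (hf : IsDensity P ν f) (hg : IsDensity Q ν g) :
    ∫ z, (f z + g z) / 2 ∂ν = 1 := by
  rw [integral_div, integral_add hf.integrable hg.integrable, hf.integral_eq_one,
    hg.integral_eq_one]
  norm_num

theorem sqHellinger_nonneg (hf : IsDensity P ν f) (hg : IsDensity Q ν g) :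
    0 ≤ sqHellinger ν f g := by
  rw [sqHellinger, sub_nonneg, ← hf.integral_half_add hg]
  exact integral_mono (hf.integrable_sqrt_mul hg)
    ((hf.integrable.add hg.integrable).div_const 2)
    fun z => sqrt_mul_le_half_add (hf.nonneg z) (hg.nonneg z)

theorem sqHellinger_le_of_abs_sub_le [IsFiniteMeasure ν] (hf : IsDensity P ν f)
    (hg : IsDensity Q ν g) {m C : ℝ} (hm : 0 < m) (hfm : ∀ z, m ≤ f z) (hgm : ∀ z, m ≤ g z)
    (hfg : ∀ z, |f z - g z| ≤ C) :
    sqHellinger ν f g ≤ C ^ 2 / (8 * m) * ν.real Set.univ := by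
  have hint : Integrable (fun z => (f z + g z) / 2) ν :=
    (hf.integrable.add hg.integrable).div_const 2
  have hpoint : ∀ z, (f z + g z) / 2 - C ^ 2 / (8 * m) ≤ √(f z * g z) := fun z => by
    refine le_trans ?_ (half_add_sub_le_sqrt_mul hm (hfm z) (hgm z))
    gcongr (f z + g z) / 2 - ?_ / _
    exact sq_le_sq' (abs_le.1 (hfg z)).1 (abs_le.1 (hfg z)).2
  have hmono := integral_mono (hint.sub (integrable_const _)) (hf.integrable_sqrt_mul hg) hpoint
  simp only [Pi.sub_apply] at hmono
  rw [integral_sub hint (integrable_const _), hf.integral_half_add hg, integral_const,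
    smul_eq_mul, mul_comm] at hmono
  rw [sqHellinger]
  linarith

theorem le_integral_min (hf : IsDensity P ν f) (hg : IsDensity Q ν g) :
    4 / 3 * (1 / 2 - sqHellinger ν f g) ≤ ∫ z, min (f z) (g z) ∂ν := by
  have hmin : Integrable (fun z => min (f z) (g z)) ν := hf.integrable.inf hg.integrable
  have hhalf : Integrable (fun z => (f z + g z) / 2) ν :=
    (hf.integrable.add hg.integrable).div_const 2
  have hpoint : ∀ z, √(f z * g z) ≤ 3 / 4 * min (f z) (g z) + 1 / 2 * ((f z + g z) / 2) :=
    fun z => by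
      linarith [sqrt_mul_le_min_add_max (hf.nonneg z) (hg.nonneg z), min_add_max (f z) (g z)]
  have hmono := integral_mono (hf.integrable_sqrt_mul hg)
    ((hmin.const_mul _).add (hhalf.const_mul _)) hpoint
  simp only [Pi.add_apply] at hmono
  rw [integral_add (hmin.const_mul _) (hhalf.const_mul _), integral_const_mul,
    integral_const_mul, hf.integral_half_add hg] at hmono
  rw [sqHellinger]
  linarith

theorem ofReal_le_lintegral_min (hf : IsDensity P ν f) (hg : IsDensity Q ν g) :
    ENNReal.ofReal (4 / 3 * (1 / 2 - sqHellinger ν f g)) ≤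
      ∫⁻ z, min (ENNReal.ofReal (f z)) (ENNReal.ofReal (g z)) ∂ν := by
  have hmin : Integrable (fun z => min (f z) (g z)) ν := hf.integrable.inf hg.integrable
  simp only [← ENNReal.ofReal_min]
  rw [← ofReal_integral_eq_lintegral_ofReal hmin
    (ae_of_all _ fun z => le_min (hf.nonneg z) (hg.nonneg z))]
  exact ENNReal.ofReal_le_ofReal (le_integral_min hf hg)

end Hellinger

theorem one_sub_prod_le_sum {ι : Type*} (s : Finset ι) {a : ι → ℝ} (h0 : ∀ i ∈ s, 0 ≤ a i)
    (h1 : ∀ i ∈ s, a i ≤ 1) : 1 - ∏ i ∈ s, a i ≤ ∑ i ∈ s, (1 - a i) := by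
  induction s using Finset.cons_induction with
  | empty => simp
  | cons i s hi ih =>
    rw [Finset.forall_mem_cons] at h0 h1
    rw [Finset.prod_cons, Finset.sum_cons]
    have hprod : ∏ j ∈ s, a j ≤ 1 := Finset.prod_le_one h0.2 h1.2
    nlinarith [ih h0.2 h1.2]

theorem sqHellinger_pi_le {ι : Type*} [Fintype ι] {Z : ι → Type*} [∀ i, MeasurableSpace (Z i)]
    {P Q ν : ∀ i, Measure (Z i)} [∀ i, IsProbabilityMeasure (P i)]
    [∀ i, IsProbabilityMeasure (Q i)] [∀ i, SigmaFinite (ν i)] {f g : ∀ i, Z i → ℝ}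
    (hf : ∀ i, IsDensity (P i) (ν i) (f i)) (hg : ∀ i, IsDensity (Q i) (ν i) (g i)) :
    sqHellinger (Measure.pi ν) (fun z => ∏ i, f i (z i)) (fun z => ∏ i, g i (z i)) ≤
      ∑ i, sqHellinger (ν i) (f i) (g i) := by
  have hsqrt : ∀ z : ∀ i, Z i, √((∏ i, f i (z i)) * ∏ i, g i (z i)) =
      ∏ i, √(f i (z i) * g i (z i)) := fun z => by
    rw [← Finset.prod_mul_distrib,
      Real.sqrt_prod _ fun i _ => mul_nonneg ((hf i).nonneg _) ((hg i).nonneg _)]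
  simp only [sqHellinger, hsqrt]
  rw [integral_fintype_prod_eq_prod (𝕜 := ℝ) fun i z => √(f i z * g i z)]
  exact one_sub_prod_le_sum _ (fun i _ => integral_nonneg fun _ => Real.sqrt_nonneg _)
    fun i _ => sub_nonneg.1 (sqHellinger_nonneg (hf i) (hg i))

/-- The sign by which a bit enters a coordinate of a vertex of a cube centred at the origin. -/
def bitSign (b : Bool) : ℝ := if b then 1 else -1

theorem bitSign_not (b : Bool) : bitSign (!b) = -bitSign b := by
  cases b <;> simp [bitSign]

theorem bitSign_sq (b : Bool) : bitSign b ^ 2 = 1 := by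
  cases b <;> simp [bitSign]

theorem two_mul_sq_le_sq_sub_add_sq_sub (δ x : ℝ) (b : Bool) :
    2 * δ ^ 2 ≤ (x - δ * bitSign b) ^ 2 + (x - δ * bitSign (!b)) ^ 2 := by
  rw [bitSign_not]
  linear_combination -2 * δ ^ 2 * bitSign_sq b + 2 * sq_nonneg x

section Assouad

variable {ι : Type*} [DecidableEq ι]

/-- The neighbour of the vertex `v` of the discrete cube along the edge in direction `j`. -/
def flipBit (j : ι) (v : ι → Bool) : ι → Bool := Function.update v j (!v j)

theorem flipBit_self (j : ι) (v : ι → Bool) : flipBit j v j = !v j :=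
  Function.update_self ..

theorem flipBit_of_ne {i j : ι} (h : i ≠ j) (v : ι → Bool) : flipBit j v i = v i :=
  Function.update_of_ne h ..

theorem flipBit_involutive (j : ι) : Function.Involutive (flipBit j) := fun v => by
  simp only [flipBit, Function.update_self, Bool.not_not, Function.update_idem,
    Function.update_eq_self]

variable [Fintype ι]

theorem exists_le_two_mul_sum {A : ι → (ι → Bool) → ℝ≥0∞} {K : ℝ≥0∞}
    (h : ∀ v, K ≤ ∑ j, (A j v + A j (flipBit j v))) : ∃ v, K ≤ 2 * ∑ j, A j v := by
  by_contra! hlt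
  have hflip : ∀ j, ∑ v, A j (flipBit j v) = ∑ v, A j v := fun j =>
    Equiv.sum_comp (flipBit_involutive j).toPerm (A j)
  have hsum : ∑ v, ∑ j, (A j v + A j (flipBit j v)) = ∑ v, 2 * ∑ j, A j v := by
    simp only [Finset.mul_sum, two_mul]
    rw [Finset.sum_comm, Finset.sum_comm (γ := ι → Bool)]
    simp only [Finset.sum_add_distrib, hflip]
  have hstrict : ∑ v, 2 * ∑ j, A j v < ∑ _v : ι → Bool, K :=
    ENNReal.sum_lt_sum_of_nonempty Finset.univ_nonempty fun v _ => hlt v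
  exact (hstrict.trans_le (Finset.sum_le_sum fun v _ => h v)).ne' hsum

theorem mul_lintegral_min_le {Ω : Type*} [MeasurableSpace Ω] {ν : Measure Ω}
    {p q ℓ₀ ℓ₁ : Ω → ℝ≥0∞} {c : ℝ≥0∞} (hp : Measurable p) (hq : Measurable q)
    (hℓ₀ : Measurable ℓ₀) (hc : ∀ z, c ≤ ℓ₀ z + ℓ₁ z) :
    c * ∫⁻ z, min (p z) (q z) ∂ν ≤ ∫⁻ z, p z * ℓ₀ z ∂ν + ∫⁻ z, q z * ℓ₁ z ∂ν := by
  rw [← lintegral_const_mul c (hp.min hq),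
    ← lintegral_add_left (f := fun z => p z * ℓ₀ z) (hp.mul hℓ₀)]
  refine lintegral_mono fun z => ?_
  calc c * min (p z) (q z) ≤ (ℓ₀ z + ℓ₁ z) * min (p z) (q z) := by gcongr; exact hc z
    _ = min (p z) (q z) * ℓ₀ z + min (p z) (q z) * ℓ₁ z := by ring
    _ ≤ p z * ℓ₀ z + q z * ℓ₁ z := by gcongr; exacts [min_le_left .., min_le_right ..]

theorem assouad {Ω : Type*} [MeasurableSpace Ω] {ν : Measure Ω} {p : (ι → Bool) → Ω → ℝ≥0∞}
    {ℓ : ι → Bool → Ω → ℝ≥0∞} {c K : ℝ≥0∞} (hp : ∀ v, Measurable (p v))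
    (hℓ : ∀ j b, Measurable (ℓ j b)) (hc : ∀ j b z, c ≤ ℓ j b z + ℓ j (!b) z)
    (hK : ∀ v, K ≤ ∑ j, ∫⁻ z, min (p v z) (p (flipBit j v) z) ∂ν) :
    ∃ v, c * K ≤ 2 * ∑ j, ∫⁻ z, p v z * ℓ j (v j) z ∂ν := by
  refine exists_le_two_mul_sum fun v => ?_
  calc c * K ≤ ∑ j, c * ∫⁻ z, min (p v z) (p (flipBit j v) z) ∂ν := by
        rw [← Finset.mul_sum]
        gcongr
        exact hK v
    _ ≤ _ := by
        gcongr with j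
        rw [flipBit_self]
        exact mul_lintegral_min_le (hp v) (hp _) (hℓ j (v j)) (hc j (v j))

theorem assouad_of_sum_sqHellinger_le {Ω : Type*} [MeasurableSpace Ω] {ν : Measure Ω}
    {P : (ι → Bool) → Measure Ω} [∀ v, IsProbabilityMeasure (P v)] {f : (ι → Bool) → Ω → ℝ}
    {ℓ : ι → Bool → Ω → ℝ≥0∞} {c : ℝ≥0∞} (hf : ∀ v, IsDensity (P v) ν (f v))
    (hℓ : ∀ j b, Measurable (ℓ j b)) (hc : ∀ j b z, c ≤ ℓ j b z + ℓ j (!b) z)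
    (hsum : ∀ v, ∑ j, sqHellinger ν (f v) (f (flipBit j v)) ≤ Fintype.card ι / 4) :
    ∃ v, c * ENNReal.ofReal (Fintype.card ι / 3) ≤ 2 * ∑ j, ∫⁻ z, ℓ j (v j) z ∂(P v) := by
  simp only [(hf _).lintegral_mul (hℓ _ _)]
  refine assouad (fun v => (hf v).measurable.ennreal_ofReal) hℓ hc fun v => ?_
  calc ENNReal.ofReal (Fintype.card ι / 3)
      ≤ ENNReal.ofReal (∑ j, 4 / 3 * (1 / 2 - sqHellinger ν (f v) (f (flipBit j v)))) := by
        refine ENNReal.ofReal_le_ofReal ?_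
        rw [← Finset.mul_sum, Finset.sum_sub_distrib, Finset.sum_const, Finset.card_univ,
          nsmul_eq_mul]
        linarith [hsum v]
    _ ≤ ∑ j, ENNReal.ofReal (4 / 3 * (1 / 2 - sqHellinger ν (f v) (f (flipBit j v)))) :=
        Finset.le_sum_of_subadditive _ ENNReal.ofReal_zero.le
          (fun _ _ => ENNReal.ofReal_add_le) _ _
    _ ≤ _ := Finset.sum_le_sum fun j _ => ofReal_le_lintegral_min (hf v) (hf _)

end Assouad

section Cube

variable {E : Type*} [NormedAddCommGroup E] [InnerProductSpace ℝ E] {ι : Type*} [Fintype ι]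
  {u : ι → E}

/-- The vertex `∑ j, ± δ • u j`, with signs given by `v`, of the cube with half-side `δ` spanned
by the family `u`. -/
noncomputable def vertex (u : ι → E) (δ : ℝ) (v : ι → Bool) : E :=
  ∑ j, (δ * bitSign (v j)) • u j

theorem inner_vertex (hu : Orthonormal ℝ u) (δ : ℝ) (v : ι → Bool) (j : ι) :
    inner ℝ (u j) (vertex u δ v) = δ * bitSign (v j) :=
  hu.inner_right_fintype _ j

theorem norm_vertex_sq (hu : Orthonormal ℝ u) (δ : ℝ) (v : ι → Bool) :
    ‖vertex u δ v‖ ^ 2 = Fintype.card ι * δ ^ 2 := by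
  rw [← real_inner_self_eq_norm_sq, vertex, hu.inner_sum]
  simp only [conj_trivial, ← sq, mul_pow, bitSign_sq, mul_one, Finset.sum_const,
    Finset.card_univ, nsmul_eq_mul]

theorem vertex_sub_vertex_flipBit [DecidableEq ι] (u : ι → E) (δ : ℝ) (v : ι → Bool) (j : ι) :
    vertex u δ v - vertex u δ (flipBit j v) = (2 * δ * bitSign (v j)) • u j := by
  rw [vertex, vertex, ← Finset.sum_sub_distrib, Finset.sum_eq_single_of_mem j (Finset.mem_univ j)]
  · rw [← sub_smul, flipBit_self, bitSign_not]
    ring_nf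
  · intro i _ hij
    rw [flipBit_of_ne hij, sub_self]

theorem sum_ofReal_sq_inner_sub_le (hu : Orthonormal ℝ u) (δ : ℝ) (v : ι → Bool) (t : E) :
    ∑ j, ENNReal.ofReal ((inner ℝ (u j) t - δ * bitSign (v j)) ^ 2) ≤ ‖t - vertex u δ v‖ₑ ^ 2 := by
  rw [← ENNReal.ofReal_sum_of_nonneg fun j _ => sq_nonneg _, ← ofReal_norm,
    ← ENNReal.ofReal_pow (norm_nonneg _)]
  refine ENNReal.ofReal_le_ofReal ?_
  simpa only [inner_sub_right, inner_vertex hu, Real.norm_eq_abs, sq_abs] using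
    hu.sum_inner_products_le (t - vertex u δ v) (s := Finset.univ)

theorem sum_vertex_eq_zero {κ : Type*} [Fintype κ] {w : ι → EuclideanSpace ℝ κ}
    (hw : ∀ j, ∑ i, w j i = 0) (δ : ℝ) (v : ι → Bool) : ∑ i, vertex w δ v i = 0 := by
  simp only [vertex, WithLp.ofLp_sum, WithLp.ofLp_smul, Finset.sum_apply, Pi.smul_apply,
    smul_eq_mul]
  rw [Finset.sum_comm]
  simp only [← Finset.mul_sum, hw, mul_zero, Finset.sum_const_zero]

variable [DecidableEq ι] [MeasurableSpace E] [OpensMeasurableSpace E]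

theorem exists_vertex_le_lintegral {Ω : Type*} [MeasurableSpace Ω] {ν : Measure Ω}
    {P : (ι → Bool) → Measure Ω} [∀ v, IsProbabilityMeasure (P v)] {f : (ι → Bool) → Ω → ℝ}
    (hf : ∀ v, IsDensity (P v) ν (f v)) (hu : Orthonormal ℝ u) (δ : ℝ)
    (hsum : ∀ v, ∑ j, sqHellinger ν (f v) (f (flipBit j v)) ≤ Fintype.card ι / 4)
    (est : Kernel Ω E) [IsMarkovKernel est] :
    ∃ v, ENNReal.ofReal (δ ^ 2 * (Fintype.card ι / 3)) ≤
      ∫⁻ z, ∫⁻ t, ‖t - vertex u δ v‖ₑ ^ 2 ∂(est z) ∂(P v) := by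
  let sqErr : ι → Bool → E → ℝ≥0∞ := fun j b t =>
    ENNReal.ofReal ((inner ℝ (u j) t - δ * bitSign b) ^ 2)
  have hmeas : ∀ j b, Measurable (sqErr j b) := fun j b => by fun_prop
  have hloss : ∀ j b z, ENNReal.ofReal (2 * δ ^ 2) ≤
      ∫⁻ t, sqErr j b t ∂est z + ∫⁻ t, sqErr j (!b) t ∂est z := fun j b z => by
    rw [← lintegral_add_left (hmeas j b), ← mul_one (ENNReal.ofReal _),
      ← measure_univ (μ := est z), ← lintegral_const]
    refine lintegral_mono fun t => ?_
    rw [← ENNReal.ofReal_add (sq_nonneg _) (sq_nonneg _)]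
    exact ENNReal.ofReal_le_ofReal (two_mul_sq_le_sq_sub_add_sq_sub ..)
  obtain ⟨v, hv⟩ :=
    assouad_of_sum_sqHellinger_le hf (fun j b => (hmeas j b).lintegral_kernel) hloss hsum
  have hrisk : ∑ j, ∫⁻ z, ∫⁻ t, sqErr j (v j) t ∂(est z) ∂(P v) ≤
      ∫⁻ z, ∫⁻ t, ‖t - vertex u δ v‖ₑ ^ 2 ∂(est z) ∂(P v) := by
    rw [← lintegral_finsetSum _ fun j _ => (hmeas j (v j)).lintegral_kernel]
    refine lintegral_mono fun z => ?_
    rw [← lintegral_finsetSum _ fun j _ => hmeas j (v j)]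
    exact lintegral_mono fun t => sum_ofReal_sq_inner_sub_le hu δ v t
  refine ⟨v, (ENNReal.mul_le_mul_iff_right two_ne_zero ENNReal.ofNat_ne_top).1 ?_⟩
  calc 2 * ENNReal.ofReal (δ ^ 2 * (Fintype.card ι / 3))
      = ENNReal.ofReal (2 * δ ^ 2) * ENNReal.ofReal (Fintype.card ι / 3) := by
        rw [← ENNReal.ofReal_mul (by positivity), mul_assoc, ENNReal.ofReal_mul two_pos.le,
          ENNReal.ofReal_ofNat]
    _ ≤ _ := hv.trans (by gcongr)

end Cube

section Privacy

variable {Z : Type*} [MeasurableSpace Z]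

theorem ae_toReal_rnDeriv_le {P ν : Measure Z} [SigmaFinite ν] {c : ℝ} (hc : 0 ≤ c)
    (h : P ≤ ENNReal.ofReal c • ν) : ∀ᵐ z ∂ν, (P.rnDeriv ν z).toReal ≤ c := by
  have hle : P.rnDeriv ν ≤ᵐ[ν] fun _ => ENNReal.ofReal c := by
    refine ae_le_of_forall_setLIntegral_le_of_sigmaFinite (P.measurable_rnDeriv ν) fun s _ _ => ?_
    rw [setLIntegral_const]
    exact (Measure.setLIntegral_rnDeriv_le s).trans (h s)
  filter_upwards [hle] with z hz
  exact ENNReal.toReal_le_of_le_ofReal hc hz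

theorem IsDensity.of_ae_eq {P ν : Measure Z} [IsFiniteMeasure P] [IsFiniteMeasure ν]
    {f : Z → ℝ} (hP : P ≤ ν) (hf : Measurable f) (hf0 : ∀ z, 0 ≤ f z)
    (h : (fun z => (P.rnDeriv ν z).toReal) =ᵐ[ν] f) : IsDensity P ν f where
  measurable := hf
  nonneg := hf0
  withDensity_eq := by
    rw [← Measure.withDensity_rnDeriv_eq P ν (Measure.absolutelyContinuous_of_le hP)]
    refine withDensity_congr_ae ?_
    filter_upwards [h, Measure.rnDeriv_lt_top P ν] with z hz hfin
    rw [← hz, ENNReal.ofReal_toReal hfin.ne]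

theorem exists_isDensity_pair_of_le_smul_add {P Q : Measure Z} [IsFiniteMeasure P]
    [IsFiniteMeasure Q] {c : ℝ} (hc : c ∈ Set.Icc (1 / 2) 1) (hP : P ≤ ENNReal.ofReal c • (P + Q))
    (hQ : Q ≤ ENNReal.ofReal c • (P + Q)) :
    ∃ f g, IsDensity P (P + Q) f ∧ IsDensity Q (P + Q) g ∧ (∀ z, f z + g z = 1) ∧
      ∀ z, |g z - f z| ≤ 2 * c - 1 := by
  have hc0 : 0 ≤ c := by linarith [hc.1]
  set ν := P + Q with hν
  have hadd : ∀ᵐ z ∂ν, P.rnDeriv ν z + Q.rnDeriv ν z = 1 := by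
    filter_upwards [Measure.rnDeriv_add P Q ν, Measure.rnDeriv_self ν] with z hz hself
    rw [← Pi.add_apply, ← hz, ← hν, hself]
  have hreal : ∀ᵐ z ∂ν, (P.rnDeriv ν z).toReal = 1 - (Q.rnDeriv ν z).toReal := by
    filter_upwards [hadd, Measure.rnDeriv_lt_top P ν, Measure.rnDeriv_lt_top Q ν] with z hz hp hq
    rw [eq_sub_iff_add_eq, ← ENNReal.toReal_add hp.ne hq.ne, hz, ENNReal.toReal_one]
  have hmem : ∀ᵐ z ∂ν, (Q.rnDeriv ν z).toReal ∈ Set.Icc (1 - c) c := by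
    filter_upwards [hreal, ae_toReal_rnDeriv_le hc0 hP, ae_toReal_rnDeriv_le hc0 hQ]
      with z hz hp hq
    exact ⟨by linarith, hq⟩
  obtain ⟨g, hg, hrange, hgQ⟩ :=
    (Q.measurable_rnDeriv ν).ennreal_toReal.aemeasurable.exists_ae_eq_range_subset hmem
      ⟨c, by linarith [hc.1], le_rfl⟩
  have hgc : ∀ z, g z ∈ Set.Icc (1 - c) c := fun z => hrange (Set.mem_range_self z)
  have hf : (fun z => (P.rnDeriv ν z).toReal) =ᵐ[ν] fun z => 1 - g z := by
    filter_upwards [hreal, hgQ] with z hz hgz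
    rw [hz, hgz]
  refine ⟨fun z => 1 - g z, g, .of_ae_eq (Measure.le_add_right le_rfl) (measurable_const.sub hg)
    (fun z => ?_) hf, .of_ae_eq (Measure.le_add_left le_rfl) hg (fun z => ?_) hgQ,
    fun z => sub_add_cancel _ _, fun z => abs_le.2 ⟨?_, ?_⟩⟩
  all_goals linarith [hc.2, (hgc z).1, (hgc z).2]

theorem le_sigmoid_smul_add {P Q : Measure Z} {ε : ℝ} (h : P ≤ ENNReal.ofReal (Real.exp ε) • Q) :
    P ≤ ENNReal.ofReal (Real.sigmoid ε) • (P + Q) := by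
  have hσ : (1 - Real.sigmoid ε) * Real.exp ε = Real.sigmoid ε := by
    rw [← Real.sigmoid_neg]
    simpa only [neg_neg] using Real.sigmoid_mul_rexp_neg (-ε)
  have hσ' : 0 ≤ 1 - Real.sigmoid ε := sub_nonneg.2 (Real.sigmoid_le_one ε)
  calc P = ENNReal.ofReal (Real.sigmoid ε) • P + ENNReal.ofReal (1 - Real.sigmoid ε) • P := by
        rw [← add_smul, ← ENNReal.ofReal_add (Real.sigmoid_nonneg ε) hσ', add_sub_cancel,
          ENNReal.ofReal_one, one_smul]
    _ ≤ ENNReal.ofReal (Real.sigmoid ε) • P +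
          ENNReal.ofReal (1 - Real.sigmoid ε) • ENNReal.ofReal (Real.exp ε) • Q := by gcongr
    _ = _ := by rw [smul_smul, ← ENNReal.ofReal_mul hσ', hσ, smul_add]

theorem IsLabelDPRandomizer.exists_isDensity {R : Kernel (Fin 2) Z} [IsMarkovKernel R] {ε : ℝ}
    (hε : 0 ≤ ε) (hR : IsLabelDPRandomizer ε 0 R) :
    ∃ f : Fin 2 → Z → ℝ, (∀ y, IsDensity (R y) (R 0 + R 1) (f y)) ∧
      (∀ z, f 0 z + f 1 z = 1) ∧ ∀ z, |f 1 z - f 0 z| ≤ 2 * Real.sigmoid ε - 1 := by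
  have hle : ∀ y y', R y ≤ ENNReal.ofReal (Real.exp ε) • R y' := fun y y' =>
    Measure.le_iff.2 fun E hE => by
      simpa only [ENNReal.ofReal_zero, add_zero, Measure.smul_apply, smul_eq_mul] using hR y y' E hE
  have hσ : Real.sigmoid ε ∈ Set.Icc (1 / 2) 1 :=
    ⟨by simpa only [Real.sigmoid_zero, one_div] using Real.sigmoid_le hε, Real.sigmoid_le_one ε⟩
  obtain ⟨f, g, hf, hg, hsum, hdiff⟩ := exists_isDensity_pair_of_le_smul_add hσ
    (le_sigmoid_smul_add (hle 0 1)) (add_comm (R 1) (R 0) ▸ le_sigmoid_smul_add (hle 1 0))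
  exact ⟨![f, g], Fin.forall_fin_two.2 ⟨hf, hg⟩, hsum, hdiff⟩

theorem isProbabilityMeasure_convexComb {P Q : Measure Z} [IsProbabilityMeasure P]
    [IsProbabilityMeasure Q] {q : ℝ} (hq : q ∈ Set.Icc 0 1) :
    IsProbabilityMeasure (ENNReal.ofReal (1 - q) • P + ENNReal.ofReal q • Q) where
  measure_univ := by
    simp only [Measure.add_apply, Measure.smul_apply, measure_univ, smul_eq_mul, mul_one]
    rw [← ENNReal.ofReal_add (sub_nonneg.2 hq.2) hq.1, sub_add_cancel, ENNReal.ofReal_one]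

/-- The density of the privatized label when the true label is `1` with probability `q` and `f y`
is the density of the output of the randomizer on the label `y`. -/
def mixDensity (q : ℝ) (f : Fin 2 → Z → ℝ) (z : Z) : ℝ := (1 - q) * f 0 z + q * f 1 z

theorem sqHellinger_mixDensity_le {P : Fin 2 → Measure Z} [∀ y, IsProbabilityMeasure (P y)]
    {f : Fin 2 → Z → ℝ} (hf : ∀ y, IsDensity (P y) (P 0 + P 1) (f y))
    (hsum : ∀ z, f 0 z + f 1 z = 1) {τ : ℝ} (hτ : ∀ z, |f 1 z - f 0 z| ≤ τ) {p q : ℝ}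
    (hp : p ∈ Set.Icc (1 / 4) (3 / 4)) (hq : q ∈ Set.Icc (1 / 4) (3 / 4)) :
    sqHellinger (P 0 + P 1) (mixDensity p f) (mixDensity q f) ≤ (p - q) ^ 2 * τ ^ 2 := by
  have hsub : Set.Icc (1 / 4 : ℝ) (3 / 4) ⊆ Set.Icc 0 1 :=
    Set.Icc_subset_Icc (by norm_num) (by norm_num)
  have hge : ∀ r ∈ Set.Icc (1 / 4 : ℝ) (3 / 4), ∀ z, 1 / 4 ≤ mixDensity r f z := fun r hr z => by
    rw [mixDensity]
    nlinarith [hr.1, hr.2, (hf 0).nonneg z, (hf 1).nonneg z, hsum z]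
  have hdiff : ∀ z, |mixDensity p f z - mixDensity q f z| ≤ |p - q| * τ := fun z => by
    rw [mixDensity, mixDensity, show (1 - p) * f 0 z + p * f 1 z - ((1 - q) * f 0 z + q * f 1 z) =
      (p - q) * (f 1 z - f 0 z) by ring, abs_mul]
    exact mul_le_mul_of_nonneg_left (hτ z) (abs_nonneg _)
  have := isProbabilityMeasure_convexComb (P := P 0) (Q := P 1) (hsub hp)
  have := isProbabilityMeasure_convexComb (P := P 0) (Q := P 1) (hsub hq)
  have hmass : (P 0 + P 1).real Set.univ = 2 := by
    rw [measureReal_add_apply, probReal_univ, probReal_univ, one_add_one_eq_two]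
  refine (sqHellinger_le_of_abs_sub_le ((hf 0).convexComb (hf 1) (hsub hp))
    ((hf 0).convexComb (hf 1) (hsub hq)) (by norm_num) (hge p hp) (hge q hq) hdiff).trans_eq ?_
  rw [hmass, mul_pow, sq_abs]
  ring

end Privacy

section Sigmoid

theorem abs_sigmoid_sub_le (x y : ℝ) : |Real.sigmoid x - Real.sigmoid y| ≤ |x - y| / 4 := by
  have hderiv : ∀ t ∈ Set.univ,
      HasDerivWithinAt Real.sigmoid (Real.sigmoid t * (1 - Real.sigmoid t)) Set.univ t :=
    fun t _ => (Real.hasDerivAt_sigmoid t).hasDerivWithinAt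
  have hbound : ∀ t ∈ Set.univ, ‖Real.sigmoid t * (1 - Real.sigmoid t)‖ ≤ 1 / 4 := fun t _ => by
    rw [Real.norm_of_nonneg
      (mul_nonneg (Real.sigmoid_nonneg t) (sub_nonneg.2 (Real.sigmoid_le_one t)))]
    nlinarith [sq_nonneg (2 * Real.sigmoid t - 1)]
  have := convex_univ.norm_image_sub_le_of_norm_hasDerivWithin_le hderiv hbound
    (Set.mem_univ y) (Set.mem_univ x)
  rwa [Real.norm_eq_abs, Real.norm_eq_abs, one_div_mul_eq_div] at this

theorem sigmoid_mem_Icc {x : ℝ} (hx : |x| ≤ 1) : Real.sigmoid x ∈ Set.Icc (1 / 4) (3 / 4) := by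
  have h := abs_sigmoid_sub_le x 0
  rw [sub_zero, Real.sigmoid_zero] at h
  obtain ⟨hlo, hhi⟩ := abs_le.1 h
  constructor <;> linarith

theorem sum_sq_sigmoid_inner_vertex_sub_le {E : Type*} [NormedAddCommGroup E]
    [InnerProductSpace ℝ E] {ι : Type*} [Fintype ι] [DecidableEq ι] {u : ι → E}
    (hu : Orthonormal ℝ u) (δ : ℝ) (v : ι → Bool) (x : E) :
    ∑ j, (Real.sigmoid (inner ℝ x (vertex u δ v)) -
      Real.sigmoid (inner ℝ x (vertex u δ (flipBit j v)))) ^ 2 ≤ δ ^ 2 * ‖x‖ ^ 2 / 4 := by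
  calc _ ≤ ∑ j, δ ^ 2 / 4 * inner ℝ (u j) x ^ 2 := Finset.sum_le_sum fun j _ => by
        have hinner : inner ℝ x (vertex u δ v) - inner ℝ x (vertex u δ (flipBit j v)) =
            2 * δ * bitSign (v j) * inner ℝ (u j) x := by
          rw [← inner_sub_right, vertex_sub_vertex_flipBit, inner_smul_right, real_inner_comm]
        calc _ ≤ (|inner ℝ x (vertex u δ v) - inner ℝ x (vertex u δ (flipBit j v))| / 4) ^ 2 :=
              sq_le_sq.2 ((abs_sigmoid_sub_le _ _).trans (le_abs_self _))
          _ = δ ^ 2 / 4 * inner ℝ (u j) x ^ 2 := by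
              rw [div_pow, sq_abs, hinner]
              linear_combination δ ^ 2 * inner ℝ (u j) x ^ 2 / 4 * bitSign_sq (v j)
    _ ≤ δ ^ 2 / 4 * ‖x‖ ^ 2 := by
        rw [← Finset.mul_sum]
        gcongr
        simpa only [Real.norm_eq_abs, sq_abs] using
          hu.sum_inner_products_le x (s := Finset.univ)
    _ = _ := by ring

end Sigmoid

section BradleyTerryLuce

variable {S A : Type*} {d : ℕ}

/-- The feature difference `φ(s, a¹) - φ(s, a⁰)` of a query, through which alone the
Bradley-Terry-Luce law depends on the features. -/
def featureDiff (φ : S → A → EuclideanSpace ℝ (Fin d)) (s : S) (a : Fin 2 → A) :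
    EuclideanSpace ℝ (Fin d) :=
  φ s (a 1) - φ s (a 0)

theorem norm_featureDiff_le {φ : S → A → EuclideanSpace ℝ (Fin d)} {L : ℝ}
    (hφ : ∀ s a, ‖φ s a‖ ≤ L) (s : S) (a : Fin 2 → A) : ‖featureDiff φ s a‖ ≤ 2 * L :=
  (norm_sub_le _ _).trans (by linarith [hφ s (a 0), hφ s (a 1)])

theorem btlProb_one (φ : S → A → EuclideanSpace ℝ (Fin d)) (θ : EuclideanSpace ℝ (Fin d)) (s : S)
    (a : Fin 2 → A) : btlProb φ θ s a 1 = Real.sigmoid (inner ℝ (featureDiff φ s a) θ) := by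
  rw [btlProb, featureDiff, inner_sub_left, ← reward, ← reward, Real.sigmoid_def, neg_sub,
    Real.exp_sub]
  field_simp
  rw [add_comm]

theorem btlProb_zero (φ : S → A → EuclideanSpace ℝ (Fin d)) (θ : EuclideanSpace ℝ (Fin d))
    (s : S) (a : Fin 2 → A) :
    btlProb φ θ s a 0 = 1 - Real.sigmoid (inner ℝ (featureDiff φ s a) θ) := by
  rw [← btlProb_one, eq_sub_iff_add_eq, btlProb, btlProb, ← add_div, div_self (by positivity)]

theorem labelLaw_bind {Z : Type*} [MeasurableSpace Z] (φ : S → A → EuclideanSpace ℝ (Fin d))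
    (θ : EuclideanSpace ℝ (Fin d)) (s : S) (a : Fin 2 → A) (R : Kernel (Fin 2) Z) :
    (labelLaw φ θ s a).bind R = ENNReal.ofReal (btlProb φ θ s a 0) • R 0 +
      ENNReal.ofReal (btlProb φ θ s a 1) • R 1 := by
  ext E hE
  rw [Measure.bind_apply hE R.measurable.aemeasurable, labelLaw, Fin.sum_univ_two,
    lintegral_add_measure, lintegral_smul_measure, lintegral_smul_measure, lintegral_dirac,
    lintegral_dirac]
  rfl

theorem isDensity_labelLaw_bind {Z : Type*} [MeasurableSpace Z]
    (φ : S → A → EuclideanSpace ℝ (Fin d)) (θ : EuclideanSpace ℝ (Fin d)) (s : S) (a : Fin 2 → A)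
    {R : Kernel (Fin 2) Z} {ν : Measure Z} {f : Fin 2 → Z → ℝ}
    (hf : ∀ y, IsDensity (R y) ν (f y)) :
    IsDensity ((labelLaw φ θ s a).bind R) ν
      (mixDensity (Real.sigmoid (inner ℝ (featureDiff φ s a) θ)) f) := by
  rw [labelLaw_bind, btlProb_zero, btlProb_one]
  exact (hf 0).convexComb (hf 1) ⟨Real.sigmoid_nonneg _, Real.sigmoid_le_one _⟩

variable {n : ℕ} {Z : Fin n → Type*}

/-- The density of `privateLaw` when `f i y` is the density of the output of the `i`-th randomizer
on the label `y`. -/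
noncomputable def privateDensity (φ : S → A → EuclideanSpace ℝ (Fin d))
    (θ : EuclideanSpace ℝ (Fin d)) (s : Fin n → S) (a : Fin n → Fin 2 → A)
    (f : ∀ i, Fin 2 → Z i → ℝ) (z : ∀ i, Z i) : ℝ :=
  ∏ i, mixDensity (Real.sigmoid (inner ℝ (featureDiff φ (s i) (a i)) θ)) (f i) (z i)

variable [∀ i, MeasurableSpace (Z i)] {R : ∀ i, Kernel (Fin 2) (Z i)} [∀ i, IsMarkovKernel (R i)]
  {φ : S → A → EuclideanSpace ℝ (Fin d)} {θ θ' : EuclideanSpace ℝ (Fin d)} {s : Fin n → S}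
  {a : Fin n → Fin 2 → A} {f : ∀ i, Fin 2 → Z i → ℝ}

theorem isDensity_privateLaw {ν : ∀ i, Measure (Z i)} [∀ i, SigmaFinite (ν i)]
    (hf : ∀ i y, IsDensity (R i y) (ν i) (f i y)) :
    IsDensity (privateLaw φ θ s a R) (Measure.pi ν) (privateDensity φ θ s a f) :=
  .pi fun i => isDensity_labelLaw_bind φ θ (s i) (a i) (hf i)

theorem sqHellinger_privateDensity_le
    (hf : ∀ i y, IsDensity (R i y) (R i 0 + R i 1) (f i y))
    (hsum : ∀ i z, f i 0 z + f i 1 z = 1) {τ : ℝ} (hτ : ∀ i z, |f i 1 z - f i 0 z| ≤ τ)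
    (hθ : ∀ i, |inner ℝ (featureDiff φ (s i) (a i)) θ| ≤ 1)
    (hθ' : ∀ i, |inner ℝ (featureDiff φ (s i) (a i)) θ'| ≤ 1) :
    sqHellinger (Measure.pi fun i => R i 0 + R i 1) (privateDensity φ θ s a f)
        (privateDensity φ θ' s a f) ≤
      ∑ i, (Real.sigmoid (inner ℝ (featureDiff φ (s i) (a i)) θ) -
        Real.sigmoid (inner ℝ (featureDiff φ (s i) (a i)) θ')) ^ 2 * τ ^ 2 :=
  (sqHellinger_pi_le (fun i => isDensity_labelLaw_bind φ θ (s i) (a i) (hf i))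
    fun i => isDensity_labelLaw_bind φ θ' (s i) (a i) (hf i)).trans <|
    Finset.sum_le_sum fun i _ => sqHellinger_mixDensity_le (hf i) (hsum i) (hτ i)
      (sigmoid_mem_Icc (hθ i)) (sigmoid_mem_Icc (hθ' i))

theorem abs_inner_featureDiff_le_one {L : ℝ} (hφ : ∀ s a, ‖φ s a‖ ≤ L)
    (hθ : 2 * L * ‖θ‖ ≤ 1) (s : S) (a : Fin 2 → A) : |inner ℝ (featureDiff φ s a) θ| ≤ 1 :=
  (abs_real_inner_le_norm _ _).trans <|
    (mul_le_mul_of_nonneg_right (norm_featureDiff_le hφ s a) (norm_nonneg θ)).trans hθ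

variable {ι : Type*} [Fintype ι] {u : ι → EuclideanSpace ℝ (Fin d)}

theorem sum_sqHellinger_privateDensity_vertex_le [DecidableEq ι] {L τ δ : ℝ}
    (hφ : ∀ s a, ‖φ s a‖ ≤ L)
    (hf : ∀ i y, IsDensity (R i y) (R i 0 + R i 1) (f i y))
    (hsum : ∀ i z, f i 0 z + f i 1 z = 1) (hτ : ∀ i z, |f i 1 z - f i 0 z| ≤ τ)
    (hu : Orthonormal ℝ u) (hδ : ∀ v, 2 * L * ‖vertex u δ v‖ ≤ 1) (v : ι → Bool) :
    ∑ j, sqHellinger (Measure.pi fun i => R i 0 + R i 1) (privateDensity φ (vertex u δ v) s a f)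
        (privateDensity φ (vertex u δ (flipBit j v)) s a f) ≤ n * (δ ^ 2 * L ^ 2 * τ ^ 2) := by
  have hinner : ∀ w i, |inner ℝ (featureDiff φ (s i) (a i)) (vertex u δ w)| ≤ 1 := fun w i =>
    abs_inner_featureDiff_le_one hφ (hδ w) (s i) (a i)
  refine (Finset.sum_le_sum fun j _ =>
    sqHellinger_privateDensity_le hf hsum hτ (hinner v) (hinner (flipBit j v))).trans ?_
  rw [Finset.sum_comm]
  refine (Finset.sum_le_card_nsmul _ _ (δ ^ 2 * L ^ 2 * τ ^ 2) fun i _ => ?_).trans_eq ?_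
  · rw [← Finset.sum_mul]
    gcongr
    calc _ ≤ δ ^ 2 * ‖featureDiff φ (s i) (a i)‖ ^ 2 / 4 :=
          sum_sq_sigmoid_inner_vertex_sub_le hu δ v _
      _ ≤ δ ^ 2 * (2 * L) ^ 2 / 4 := by gcongr; exact norm_featureDiff_le hφ _ _
      _ = δ ^ 2 * L ^ 2 := by ring
  · rw [Finset.card_univ, Fintype.card_fin, nsmul_eq_mul]

theorem exists_ofReal_le_l2Risk {L B ε δ : ℝ} (hφ : ∀ s a, ‖φ s a‖ ≤ L) (hε : 0 ≤ ε)
    (hR : ∀ i, IsLabelDPRandomizer ε 0 (R i)) (hu : Orthonormal ℝ u)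
    (hsum : ∀ j, ∑ i, u j i = 0) (hB : √(Fintype.card ι) * δ ≤ B)
    (hL : 2 * L * (√(Fintype.card ι) * δ) ≤ 1) (hδ : 0 ≤ δ)
    (hn : n * (δ ^ 2 * L ^ 2 * (2 * Real.sigmoid ε - 1) ^ 2) ≤ Fintype.card ι / 4)
    (est : Kernel (∀ i, Z i) (EuclideanSpace ℝ (Fin d))) [IsMarkovKernel est] :
    ∃ θ ∈ paramSet d B,
      ENNReal.ofReal (δ ^ 2 * (Fintype.card ι / 3)) ≤ l2Risk φ θ s a R est := by
  classical
  have hnorm : ∀ v, ‖vertex u δ v‖ = √(Fintype.card ι) * δ := fun v => by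
    rw [← Real.sqrt_sq (norm_nonneg _), norm_vertex_sq hu, Real.sqrt_mul (Nat.cast_nonneg _),
      Real.sqrt_sq hδ]
  choose f hf hf_add hf_sub using fun i => (hR i).exists_isDensity hε
  have : ∀ v, IsProbabilityMeasure (privateLaw φ (vertex u δ v) s a R) := fun v => by
    unfold privateLaw
    infer_instance
  obtain ⟨v, hv⟩ := exists_vertex_le_lintegral
    (fun v => isDensity_privateLaw (φ := φ) (θ := vertex u δ v) (s := s) (a := a) hf) hu δ
    (fun v => (sum_sqHellinger_privateDensity_vertex_le hφ hf hf_add hf_sub hu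
      (fun w => by rwa [hnorm]) v).trans hn) est
  exact ⟨vertex u δ v, ⟨sum_vertex_eq_zero hsum δ v, (hnorm v).trans_le hB⟩, hv⟩

end BradleyTerryLuce

theorem exists_orthonormal_sum_eq_zero (k : ℕ) :
    ∃ u : Fin k → EuclideanSpace ℝ (Fin (k + 1)), Orthonormal ℝ u ∧ ∀ j, ∑ i, u j i = 0 := by
  let ones : EuclideanSpace ℝ (Fin (k + 1)) := WithLp.toLp 2 1
  have hones : ones ≠ 0 := fun h => by
    simpa [ones] using congrArg (fun θ => θ 0) h
  have : Fact (Module.finrank ℝ (EuclideanSpace ℝ (Fin (k + 1))) = k + 1) :=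
    ⟨finrank_euclideanSpace_fin⟩
  let b := OrthonormalBasis.fromOrthogonalSpanSingleton (𝕜 := ℝ) k hones
  refine ⟨fun j => b j, b.orthonormal.comp_linearIsometry (Submodule.subtypeₗᵢ _), fun j => ?_⟩
  have hinner : inner ℝ ones (b j : EuclideanSpace ℝ (Fin (k + 1))) = 0 :=
    Submodule.mem_orthogonal_singleton_iff_inner_right.1 (b j).2
  simpa [ones, PiLp.inner_apply] using hinner

section Rate

/-- The half-side of the cube of parameters for `n` labels in dimension `k`, when the features have
norm at most `L` and the two output laws of each randomizer have densities differing by at most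
`τ`. -/
noncomputable def halfSide (k : ℕ) (L τ : ℝ) (n : ℕ) : ℝ := √k / (2 * L * τ * √n)

theorem halfSide_sq (k : ℕ) (L τ : ℝ) (n : ℕ) :
    halfSide k L τ n ^ 2 = k / (4 * L ^ 2 * τ ^ 2 * n) := by
  rw [halfSide, div_pow, mul_pow, Real.sq_sqrt (Nat.cast_nonneg k),
    Real.sq_sqrt (Nat.cast_nonneg n)]
  ring

theorem mul_halfSide_sq_mul {L τ : ℝ} {n : ℕ} (hL : L ≠ 0) (hτ : τ ≠ 0) (hn : n ≠ 0) (k : ℕ) :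
    n * (halfSide k L τ n ^ 2 * L ^ 2 * τ ^ 2) = k / 4 := by
  rw [halfSide_sq]
  field_simp

theorem eventually_sqrt_mul_halfSide_le (k : ℕ) (L τ : ℝ) {C : ℝ} (hC : 0 < C) :
    ∀ᶠ n : ℕ in Filter.atTop, √k * halfSide k L τ n ≤ C := by
  have hlim : Filter.Tendsto (fun n : ℕ => √k * (√k / (2 * L * τ)) / √n) Filter.atTop (nhds 0) :=
    (Real.tendsto_sqrt_atTop.comp tendsto_natCast_atTop_atTop).const_div_atTop _
  filter_upwards [hlim.eventually_le_const hC] with n hn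
  rwa [halfSide, ← div_div, ← mul_div_assoc]

theorem two_mul_sigmoid_sub_one (ε : ℝ) :
    2 * Real.sigmoid ε - 1 = (Real.exp ε - 1) / (Real.exp ε + 1) := by
  rw [Real.sigmoid_def, Real.exp_neg]
  field_simp
  ring

theorem one_add_one_div_sq_le {ε : ℝ} (hε : 0 < ε) :
    1 + 1 / (Real.exp ε - 1) ^ 2 ≤ 1 / (2 * Real.sigmoid ε - 1) ^ 2 := by
  have : 0 < Real.exp ε - 1 := sub_pos.2 (Real.one_lt_exp_iff.2 hε)
  rw [two_mul_sigmoid_sub_one, div_pow, one_div_div, ← sub_nonneg]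
  have : (Real.exp ε + 1) ^ 2 / (Real.exp ε - 1) ^ 2 - (1 + 1 / (Real.exp ε - 1) ^ 2) =
      (4 * Real.exp ε - 1) / (Real.exp ε - 1) ^ 2 := by
    field_simp
    ring
  rw [this]
  have := Real.exp_pos ε
  apply div_nonneg <;> nlinarith

theorem rate_le_halfSide_sq_mul {k n : ℕ} {L ε : ℝ} (hk : 1 ≤ k) (hε : 0 < ε) :
    1 / 48 * (((k + 1 : ℕ) : ℝ) / L ^ 2 * (((k + 1 : ℕ) : ℝ) / n +
      ((k + 1 : ℕ) : ℝ) / ((Real.exp ε - 1) ^ 2 * n))) ≤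
      halfSide k L (2 * Real.sigmoid ε - 1) n ^ 2 * (k / 3) := by
  have hk' : ((k + 1 : ℕ) : ℝ) ≤ 2 * k := by
    push_cast
    linarith [Nat.one_le_cast (α := ℝ).2 hk]
  calc _ = ((k + 1 : ℕ) : ℝ) ^ 2 / (48 * L ^ 2 * n) * (1 + 1 / (Real.exp ε - 1) ^ 2) := by
        generalize (Real.exp ε - 1) ^ 2 = x
        ring
    _ ≤ (2 * k) ^ 2 / (48 * L ^ 2 * n) * (1 / (2 * Real.sigmoid ε - 1) ^ 2) := by
        gcongr
        exact one_add_one_div_sq_le hε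
    _ = _ := by
        rw [halfSide_sq]
        generalize 2 * Real.sigmoid ε - 1 = τ
        ring

end Rate

end LabelDP

theorem mainTheorem3 :
    ∃ c : ℝ, 0 < c ∧
      ∀ (d : ℕ) (L B ε : ℝ), 2 ≤ d → 0 < L → 0 < B → 0 < ε →
        ∃ N : ℕ, ∀ n : ℕ, N ≤ n →
          ∀ (S A : Type*) (φ : S → A → EuclideanSpace ℝ (Fin d)),
            (∀ s a, ‖φ s a‖ ≤ L) →
          ∀ (s : Fin n → S) (a : Fin n → Fin 2 → A)
            (Z : Fin n → Type*) [∀ i, MeasurableSpace (Z i)]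
            (R : ∀ i, Kernel (Fin 2) (Z i)) [∀ i, IsMarkovKernel (R i)],
            (∀ i, LabelDP.IsLabelDPRandomizer ε 0 (R i)) →
          ∀ (est : Kernel (∀ i, Z i) (EuclideanSpace ℝ (Fin d))) [IsMarkovKernel est],
            ∃ θ ∈ LabelDP.paramSet d B,
              ENNReal.ofReal
                  (c * ((d : ℝ) / L ^ 2 *
                    ((d : ℝ) / n + (d : ℝ) / ((Real.exp ε - 1) ^ 2 * n)))) ≤
                LabelDP.l2Risk φ θ s a R est := by
  refine ⟨1 / 48, by norm_num, fun d L B ε hd hL hB hε => ?_⟩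
  obtain ⟨k, rfl⟩ := Nat.exists_eq_add_of_le' (one_le_two.trans hd)
  have hk : 1 ≤ k := Nat.le_of_succ_le_succ hd
  obtain ⟨u, hu, hsum⟩ := LabelDP.exists_orthonormal_sum_eq_zero k
  set τ := 2 * Real.sigmoid ε - 1
  have hτ : 0 < τ := by linarith [Real.sigmoid_lt hε, Real.sigmoid_zero]
  have h2L : 0 < 2 * L := mul_pos two_pos hL
  obtain ⟨N, hN⟩ := Filter.eventually_atTop.1 <|
    (LabelDP.eventually_sqrt_mul_halfSide_le k L τ (lt_min hB (one_div_pos.2 h2L))).and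
      (Filter.eventually_ne_atTop 0)
  refine ⟨N, fun n hn S A φ hφ s a Z _ R _ hR est _ => ?_⟩
  obtain ⟨hsmall, hn0⟩ := hN n hn
  obtain ⟨hsmallB, hsmallL⟩ := le_min_iff.1 hsmall
  obtain ⟨θ, hθ, hrisk⟩ := LabelDP.exists_ofReal_le_l2Risk (B := B)
    (δ := LabelDP.halfSide k L τ n) (s := s) (a := a) hφ hε.le hR hu hsum
    (by rwa [Fintype.card_fin]) (by rwa [Fintype.card_fin, mul_comm, ← le_div_iff₀ h2L])
    (by unfold LabelDP.halfSide; positivity)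
    (by rw [Fintype.card_fin, LabelDP.mul_halfSide_sq_mul hL.ne' hτ.ne' hn0]) est
  rw [Fintype.card_fin] at hrisk
  exact ⟨θ, hθ, (ENNReal.ofReal_le_ofReal (LabelDP.rate_le_halfSide_sq_mul hk hε)).trans hrisk⟩
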